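/- Let $\mathbb N=\{0,1,2,\dots\}$ and order $\mathbb Z^2$ componentwise. Let $S$ be a submonoid of $(\mathbb N^2,+)$ that is a local good semigroup, that is: (G1) if $\alpha,\beta\in S$, then $\alpha\wedge\beta:=(\min(\alpha_1,\beta_1),\min(\alpha_2,\beta_2))\in S$; (G2) if $\alpha,\beta\in S$ and $\alpha_i=\beta_i$ for some $i\in\{1,2\}$, and $j$ denotes the other index, then there is $\delta\in S$ with $\delta_i>\alpha_i$, $\delta_j\ge\min(\alpha_j,\beta_j)$, and $\delta_j=\min(\alpha_j,\beta_j)$ if $\alpha_j\ne\beta_j$; (G3) there is $c\in S$ with $c+\mathbb N^2\subseteq S$; (local) $(0,0)$ is the only element of $S$ with a zero component. Let $e=(e_1,e_2)$ be the smallest nonzero element of $S$, let $c=\min\{\alpha\in\mathbb Z^2: \alpha+\mathbb N^2\subseteq S\}$ be the conductor of $S$, and put $\gamma=(\gamma_1,\gamma_2)=c-(1,1)$. For $\alpha\in\mathbb Z^2$ let $\Delta^S(\alpha)$ be the set of all $\beta\in S$ such that either $\beta_1=\alpha_1$ and $\beta_2>\alpha_2$, or $\beta_2=\alpha_2$ and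 $\beta_1>\alpha_1$. Assume that $S$ is symmetric, that is, for every $\alpha\in\mathbb N^2$, $\alpha\in S$ if and only if $\Delta^S(\gamma-\alpha)=\emptyset$. Let $S_1=\{\alpha_1:\alpha\in S\}$ be the first projection of $S$, and let $f(S_1)=\max(\mathbb Z\setminus S_1)$ be its Frobenius number. If $e_1\ge e_2$ and $\gamma_1>2f(S_1)+e_1$, then $e_1=e_2$. -/

import Mathlib

namespace GoodSemigroup

/-- Good subsemigroups of `ℕ²`: submonoids satisfying the axioms (G1), (G2), (G3).
Axiom (G2) is written once for each coordinate. -/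
structure IsGood (S : AddSubmonoid (ℕ × ℕ)) : Prop where
  inf_mem : ∀ α ∈ S, ∀ β ∈ S, α ⊓ β ∈ S
  exists_fst : ∀ α ∈ S, ∀ β ∈ S, α.1 = β.1 →
    ∃ δ ∈ S, α.1 < δ.1 ∧ min α.2 β.2 ≤ δ.2 ∧ (α.2 ≠ β.2 → δ.2 = min α.2 β.2)
  exists_snd : ∀ α ∈ S, ∀ β ∈ S, α.2 = β.2 →
    ∃ δ ∈ S, α.2 < δ.2 ∧ min α.1 β.1 ≤ δ.1 ∧ (α.1 ≠ β.1 → δ.1 = min α.1 β.1)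
  exists_conductor : ∃ c ∈ S, ∀ β : ℕ × ℕ, c + β ∈ S

/-- `S` is local: `(0, 0)` is its only element with a zero component. -/
def IsLocal (S : AddSubmonoid (ℕ × ℕ)) : Prop :=
  ∀ α ∈ S, (α.1 = 0 ∨ α.2 = 0) → α = 0

/-- The inclusion of `ℕ²` in `ℤ²`. -/
def toInt (α : ℕ × ℕ) : ℤ × ℤ := ((α.1 : ℤ), (α.2 : ℤ))

/-- `S`, seen as a subset of `ℤ²`. -/
def intSet (S : AddSubmonoid (ℕ × ℕ)) : Set (ℤ × ℤ) := toInt '' (S : Set (ℕ × ℕ))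

/-- `c` is the conductor of `S`: the minimum of the `α ∈ ℤ²` with `α + ℕ² ⊆ S`. -/
def IsConductor (S : AddSubmonoid (ℕ × ℕ)) (c : ℤ × ℤ) : Prop :=
  IsLeast {α : ℤ × ℤ | ∀ β : ℕ × ℕ, α + toInt β ∈ intSet S} c

/-- `γ = c - (1, 1)`, for `c` the conductor of `S`. -/
def IsGamma (S : AddSubmonoid (ℕ × ℕ)) (γ : ℤ × ℤ) : Prop :=
  ∃ c, IsConductor S c ∧ γ = c - (1, 1)

/-- `Δ₁(α)`: the points of `ℤ²` strictly above `α` on the same vertical line. -/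
def Delta₁ (α : ℤ × ℤ) : Set (ℤ × ℤ) := {β | α.1 = β.1 ∧ α.2 < β.2}

/-- `Δ₂(α)`: the points of `ℤ²` strictly on the right of `α` on the same horizontal line. -/
def Delta₂ (α : ℤ × ℤ) : Set (ℤ × ℤ) := {β | α.2 = β.2 ∧ α.1 < β.1}

/-- `Δ(α) = Δ₁(α) ∪ Δ₂(α)`. -/
def Delta (α : ℤ × ℤ) : Set (ℤ × ℤ) := Delta₁ α ∪ Delta₂ α

/-- `Δ^S(α) = Δ(α) ∩ S`. -/
def DeltaS (S : AddSubmonoid (ℕ × ℕ)) (α : ℤ × ℤ) : Set (ℤ × ℤ) := Delta α ∩ intSet S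

/-- `S` is symmetric: for every `α ∈ ℕ²`, `α ∈ S` if and only if `Δ^S(γ - α) = ∅`. -/
def IsSymmetric (S : AddSubmonoid (ℕ × ℕ)) : Prop :=
  ∃ γ, IsGamma S γ ∧ ∀ α : ℕ × ℕ, α ∈ S ↔ DeltaS S (γ - toInt α) = ∅

/-- `e` is the smallest nonzero element of `S` for the componentwise order. -/
def IsMinNonzero (S : AddSubmonoid (ℕ × ℕ)) (e : ℕ × ℕ) : Prop :=
  IsLeast {α : ℕ × ℕ | α ∈ S ∧ α ≠ 0} e

/-- The first projection `S₁` of `S`. -/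
def proj₁ (S : AddSubmonoid (ℕ × ℕ)) : AddSubmonoid ℕ := S.map (AddMonoidHom.fst ℕ ℕ)

/-- `f` is the Frobenius number of `T`: the greatest integer that is not in `T`
(so it is `-1` when `T = ℕ`). -/
def IsFrobenius (T : AddSubmonoid ℕ) (f : ℤ) : Prop :=
  IsGreatest {n : ℤ | n ∉ ((↑) : ℕ → ℤ) '' (T : Set ℕ)} f

end GoodSemigroup

namespace GoodSemigroup

variable {S : AddSubmonoid (ℕ × ℕ)}

/-! For each `a` among the `e.1` integers `f + 1, …, f + e.1`, both `a` and `γ.1 - a` lie in the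
first projection. Symmetry then bounds the fibre over `a`, and (G2) leaves nothing to the right of
its top point. If `e.2 < e.1`, two of these tops have heights congruent mod `e.2`; adding a multiple
of `e` to the lower one gives a point to the right of the other, unless the heights agree, which is
equally impossible (`not_modEq_of_right_maximal`). -/

theorem IsGamma.unique {γ γ' : ℤ × ℤ} (h : IsGamma S γ) (h' : IsGamma S γ') : γ = γ' := by
  obtain ⟨c, hc, rfl⟩ := h
  obtain ⟨c', hc', rfl⟩ := h'
  rw [IsLeast.unique hc hc']

theorem mem_intSet {a b : ℕ} (h : (a, b) ∈ S) : ((a : ℤ), (b : ℤ)) ∈ intSet S :=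
  ⟨(a, b), h, rfl⟩

theorem IsFrobenius.exists_mem {f : ℤ} (hf : IsFrobenius (proj₁ S) f) {n : ℤ} (hn : f < n) :
    ∃ a b : ℕ, (a : ℤ) = n ∧ (a, b) ∈ S := by
  by_contra! hne
  refine not_le.mpr hn (hf.2 ?_)
  rintro ⟨a, ⟨⟨x, y⟩, hx, rfl⟩, han⟩
  exact hne x y han hx

theorem IsFrobenius.neg_one_le {T : AddSubmonoid ℕ} {f : ℤ} (hf : IsFrobenius T f) : -1 ≤ f := by
  apply hf.2
  rintro ⟨a, -, ha⟩
  omega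

/-- If `γ₁ - a` lies in the first projection, then the vertical fibre of `S` over `a` is bounded
by `γ₂`. -/
theorem snd_le_of_symm {γ : ℤ × ℤ}
    (hsymm : ∀ α : ℕ × ℕ, α ∈ S ↔ DeltaS S (γ - toInt α) = ∅)
    {a y x z : ℕ} (hx : (x : ℤ) = γ.1 - a) (hxz : (x, z) ∈ S) (hay : (a, y) ∈ S) :
    (y : ℤ) ≤ γ.2 := by
  by_contra! hlt
  have hempty := (hsymm (a, y)).1 hay
  -- Any `z` will do, since `γ.2 - y < 0 ≤ z`.
  have hmem : ((x : ℤ), (z : ℤ)) ∈ DeltaS S (γ - toInt (a, y)) := by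
    refine ⟨Or.inl ⟨?_, ?_⟩, mem_intSet hxz⟩
    · simp [toInt, hx]
    · simp only [toInt, Prod.snd_sub]
      omega
  rw [hempty] at hmem
  exact hmem

/-- A bounded nonempty vertical fibre of a good semigroup has a top point, and no element of the
semigroup lies strictly to the right of it on the same horizontal line. -/
theorem IsGood.exists_maximal (hgood : IsGood S) {a y B : ℕ} (hay : (a, y) ∈ S)
    (hB : ∀ z, (a, z) ∈ S → z ≤ B) :
    ∃ m, (a, m) ∈ S ∧ ∀ b, (b, m) ∈ S → b ≤ a := by
  classical
  have hm : (a, Nat.findGreatest (fun z => (a, z) ∈ S) B) ∈ S :=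
    Nat.findGreatest_spec (P := fun z => (a, z) ∈ S) (hB y hay) hay
  refine ⟨_, hm, fun b hb => ?_⟩
  by_contra! hab
  -- As `a ≠ b`, (G2) fixes the first coordinate at `min a b = a`: the new point is higher in the
  -- same fibre.
  obtain ⟨⟨d₁, d₂⟩, hd, hgt, -, hmin⟩ := hgood.exists_snd _ hm _ hb rfl
  have hd₁ : d₁ = a := (hmin hab.ne).trans (min_eq_left hab.le)
  subst hd₁
  exact absurd (Nat.le_findGreatest (hB _ hd) hd) (not_le.mpr hgt)

/-- Two elements without elements of `S` strictly to their right, whose first coordinates differ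
by less than `e₁`, have second coordinates that are incongruent modulo `e₂`. -/
theorem not_modEq_of_right_maximal {e : ℕ × ℕ} (he : e ∈ S) {a b m n : ℕ}
    (hne : a ≠ b) (hab : a < b + e.1) (hba : b < a + e.1)
    (ham : (a, m) ∈ S) (hbn : (b, n) ∈ S)
    (ha : ∀ x, (x, m) ∈ S → x ≤ a) (hb : ∀ x, (x, n) ∈ S → x ≤ b) :
    ¬ m ≡ n [MOD e.2] := by
  intro hmod
  wlog hmn : m ≤ n generalizing a b m n
  · exact this hne.symm hba hab hbn ham hb ha hmod.symm (le_of_not_ge hmn)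
  obtain ⟨k, hk⟩ := (Nat.modEq_iff_dvd' hmn).1 hmod
  have hn : n = m + k * e.2 := by rw [mul_comm]; omega
  rcases Nat.eq_zero_or_pos k with rfl | hkpos
  · obtain rfl : n = m := by simpa using hn
    exact hne (le_antisymm (hb a ham) (ha b hbn))
  · have hmem : (a + k * e.1, n) ∈ S := by
      have := S.add_mem ham (S.nsmul_mem he k)
      rwa [hn]
    have := hb _ hmem
    have := Nat.le_mul_of_pos_left e.1 hkpos
    omega

/-- In a symmetric good semigroup, if `a` and `γ₁ - a` exceed the Frobenius number of the first
projection, then the vertical fibre over `a` has a top point with nothing strictly to its right. -/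
theorem exists_maximal_of_frobenius_lt (hgood : IsGood S) {γ : ℤ × ℤ}
    (hsymm : ∀ α : ℕ × ℕ, α ∈ S ↔ DeltaS S (γ - toInt α) = ∅)
    {f : ℤ} (hf : IsFrobenius (proj₁ S) f) {a : ℕ} (ha : f < a) (ha' : f < γ.1 - a) :
    ∃ m, (a, m) ∈ S ∧ ∀ b, (b, m) ∈ S → b ≤ a := by
  obtain ⟨a', y, haa', hay⟩ := hf.exists_mem ha
  obtain rfl : a' = a := by exact_mod_cast haa'
  obtain ⟨x, z, hx, hxz⟩ := hf.exists_mem ha'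
  refine hgood.exists_maximal hay (B := γ.2.toNat) fun w hw => ?_
  have := snd_le_of_symm hsymm hx hxz hw
  omega

end GoodSemigroup

theorem proposition5p6 (S : AddSubmonoid (ℕ × ℕ))
    (hgood : GoodSemigroup.IsGood S) (hlocal : GoodSemigroup.IsLocal S)
    (hsymm : GoodSemigroup.IsSymmetric S)
    (e : ℕ × ℕ) (he : GoodSemigroup.IsMinNonzero S e)
    (γ : ℤ × ℤ) (hγ : GoodSemigroup.IsGamma S γ)
    (f : ℤ) (hf : GoodSemigroup.IsFrobenius (GoodSemigroup.proj₁ S) f)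
    (hle : e.1 ≥ e.2) (hlarge : γ.1 > 2 * f + (e.1 : ℤ)) :
    e.1 = e.2 := by
  obtain ⟨γ', hγ', hsymm⟩ := hsymm
  obtain rfl := hγ.unique hγ'
  obtain ⟨heS, he0⟩ := he.1
  have he2 : 0 < e.2 := Nat.pos_of_ne_zero fun h => he0 (hlocal e heS (Or.inr h))
  by_contra hne
  -- The window starts at `f + 1 ≥ 0`; at its last point `f + e.1`, `hlarge` is exactly `f < γ.1 -
  -- a`.
  obtain ⟨k, hk⟩ : ∃ k : ℕ, (k : ℤ) = f + 1 :=
    ⟨(f + 1).toNat, Int.toNat_of_nonneg (by linarith [hf.neg_one_le])⟩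
  have htop : ∀ i : Fin e.1, ∃ m, (k + (i : ℕ), m) ∈ S ∧ ∀ b, (b, m) ∈ S → b ≤ k + (i : ℕ) :=
    fun i => GoodSemigroup.exists_maximal_of_frobenius_lt hgood hsymm hf (by push_cast; omega) (by push_cast; omega)
  choose m hm hmax using htop
  obtain ⟨i, j, hij, hmod⟩ := Fintype.exists_ne_map_eq_of_card_lt
    (fun i : Fin e.1 => (⟨m i % e.2, Nat.mod_lt _ he2⟩ : Fin e.2)) (by simp; omega)
  have hij' : (i : ℕ) ≠ j := fun h => hij (Fin.ext h)
  exact GoodSemigroup.not_modEq_of_right_maximal heS (by omega) (by omega) (by omega)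
    (hm i) (hm j) (hmax i) (hmax j) (congrArg Fin.val hmod)
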